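/- **Setting.** Let $\mathcal X$ be a measurable space of contexts (for instance a compact subset of $\mathbb R^d$), $\mathcal A=\{1,\dots,K\}$ a finite set of actions, $\nu$ a probability distribution on $\mathcal X$, and for each $(x,a)$ let $p(\cdot\mid x,a)$ be a cost distribution supported in $[-1,0]$ (deterministic costs $c=c(x,a)$ are a special case). A policy $\pi$ assigns to each $x\in\mathcal X$ a probability distribution $\pi(\cdot\mid x)$ on $\mathcal A$, measurably in $x$. Let $\mu_\pi$ be the law of $(x,a,c)$ with $x\sim\nu$, $a\sim\pi(\cdot\mid x)$, $c\sim p(\cdot\mid x,a)$, and let $R(\pi)=\mathbb E_{(x,a,c)\sim\mu_\pi}[c]$ be the risk of $\pi$. Let $\pi_0$ be a fixed logging policy and let $\mathcal D_n=(x_i,a_i,c_i)_{i=1}^n$ be i.i.d. with law $\mu_{\pi_0}$. For $\alpha\in[0,1]$ put $$\hat R_n^\alpha(\pi)=\frac1n\sum_{i=1}^n c_i\,\frac{\pi(a_i\mid x_i)}{\pi_0(a_i\mid x_i)^\alpha},\qquad B_n^\alpha(\pi)=1-\frac1n\sum_{i=1}^n\mathbb E_{a\sim\pi(\cdot\mid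 x_i)}\big[\pi_0(a\mid x_i)^{1-\alpha}\big],$$ $$\bar V_n^\alpha(\pi)=\frac1n\sum_{i=1}^n\Big(\mathbb E_{a\sim\pi_0(\cdot\mid x_i)}\Big[\frac{\pi(a\mid x_i)}{\pi_0(a\mid x_i)^{2\alpha}}\Big]+\frac{\pi(a_i\mid x_i)}{\pi_0(a_i\mid x_i)^{2\alpha}}\,c_i^2\Big).$$ Let $\mathcal H$ be a measurable hypothesis space of maps $h:\mathcal X\to\mathcal A$ such that $(h,x)\mapsto h(x)$ is measurable. A probability distribution $\mathbb Q$ on $\mathcal H$ induces the policy $\pi_{\mathbb Q}(a\mid x)=\mathbb Q(\{h: h(x)=a\})$. **Proposition.** Let $n\ge1$, $\delta\in(0,1]$, $\alpha\in[0,1]$, and let $\mathbb P$ be a fixed prior (probability distribution) on $\mathcal H$. Then with probability at least $1-\delta$ over $\mathcal D_n\sim\mu_{\pi_0}^n$, the following holds simultaneously for all posteriors (probability distributions) $\mathbb Q$ on $\mathcal H$ and all $\lambda\in(0,1)$, where, if $\alpha=1$, only those $\mathbb Q$ are considered for which $\pi_{\mathbb Q}(\cdot\mid x)$ is absolutely continuous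 with respect to $\pi_0(\cdot\mid x)$ for every $x$ (that is, $\pi_0(a\mid x)=0$ implies $\pi_{\mathbb Q}(a\mid x)=0$): $$\big|R(\pi_{\mathbb Q})-\hat R_n^\alpha(\pi_{\mathbb Q})\big|\le\sqrt{\frac{\mathrm{kl}'_1(\pi_{\mathbb Q},\lambda)}{2n}}+B_n^\alpha(\pi_{\mathbb Q})+\frac{\mathrm{kl}'_2(\pi_{\mathbb Q},\lambda)}{n\lambda}+\frac{\lambda}{2}\,\bar V_n^\alpha(\pi_{\mathbb Q}),$$ where $$\mathrm{kl}'_1(\pi_{\mathbb Q},\lambda)=D_{\mathrm{KL}}(\mathbb Q\|\mathbb P)+\log\frac{8\sqrt n}{\delta\lambda},\qquad \mathrm{kl}'_2(\pi_{\mathbb Q},\lambda)=2\Big(D_{\mathrm{KL}}(\mathbb Q\|\mathbb P)+\log\frac{8}{\delta\lambda}\Big).$$ If $D_{\mathrm{KL}}(\mathbb Q\|\mathbb P)=\infty$, the right-hand side is $+\infty$ and nothing is claimed. -/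

import Mathlib

open MeasureTheory ProbabilityTheory InformationTheory
open scoped ENNReal

namespace OffPolicy

/-- The probability `π(a | x)` that the policy `π` plays action `a` in context `x`.
A policy over the `K` actions is a Markov kernel from contexts to `Fin K`. -/
noncomputable def prob {X : Type*} [MeasurableSpace X] {K : ℕ}
    (π : Kernel X (Fin K)) (x : X) (a : Fin K) : ℝ :=
  (π x).real {a}

/-- The policy `π_Q` induced by a distribution `Q` on hypotheses: `π_Q(· | x)` is the law of
`pred h x` for `h ∼ Q`, so that `π_Q(a | x) = Q {h | pred h x = a}`. -/
noncomputable def inducedPolicy {X H : Type*} [MeasurableSpace X] [MeasurableSpace H] {K : ℕ}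
    (pred : H → X → Fin K) (hpred : Measurable (fun z : H × X => pred z.1 z.2))
    (Q : Measure H) [IsProbabilityMeasure Q] : Kernel X (Fin K) where
  toFun x := Q.map (fun h => pred h x)
  measurable' := by
    refine Measure.measurable_of_measurable_coe _ fun s hs => ?_
    have h1 : ∀ x, Measurable (fun h => pred h x) := fun x =>
      hpred.comp (measurable_id.prodMk measurable_const)
    have h2 : (fun x => Q.map (fun h => pred h x) s) =
        fun x => Q ((fun h => (h, x)) ⁻¹' ((fun z : H × X => pred z.1 z.2) ⁻¹' s)) := by
      funext x
      rw [Measure.map_apply (h1 x) hs]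
      rfl
    rw [h2]
    exact measurable_measure_prodMk_right (hpred hs)

instance {X H : Type*} [MeasurableSpace X] [MeasurableSpace H] {K : ℕ}
    (pred : H → X → Fin K) (hpred : Measurable (fun z : H × X => pred z.1 z.2))
    (Q : Measure H) [IsProbabilityMeasure Q] :
    IsMarkovKernel (inducedPolicy pred hpred Q) :=
  ⟨fun _ => Measure.isProbabilityMeasure_map
    (hpred.comp (measurable_id.prodMk measurable_const)).aemeasurable⟩

theorem prob_inducedPolicy {X H : Type*} [MeasurableSpace X] [MeasurableSpace H] {K : ℕ}
    (pred : H → X → Fin K) (hpred : Measurable (fun z : H × X => pred z.1 z.2))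
    (Q : Measure H) [IsProbabilityMeasure Q] (x : X) (a : Fin K) :
    prob (inducedPolicy pred hpred Q) x a = Q.real {h | pred h x = a} :=
  map_measureReal_apply (hpred.comp (measurable_id.prodMk measurable_const))
    (measurableSet_singleton a)

/-- The law `μ_π` of `(x, a, c)` where `x ∼ ν`, `a ∼ π(· | x)` and `c ∼ p(· | x, a)`. -/
noncomputable def jointLaw {X : Type*} [MeasurableSpace X] {K : ℕ}
    (ν : Measure X) (π : Kernel X (Fin K)) (p : Kernel (X × Fin K) ℝ) :
    Measure (X × Fin K × ℝ) :=
  ν.compProd (π.compProd p)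

/-- The risk `R(π)`, the expectation of the cost `c` under `(x, a, c) ∼ μ_π`. -/
noncomputable def risk {X : Type*} [MeasurableSpace X] {K : ℕ}
    (ν : Measure X) (p : Kernel (X × Fin K) ℝ) (π : Kernel X (Fin K)) : ℝ :=
  ∫ z, z.2.2 ∂(jointLaw ν π p)

/-- The exponentially smoothed estimator
`(1/n) ∑ i, c_i * π(a_i | x_i) / π₀(a_i | x_i) ^ α` computed from logged data
`D i = (x_i, a_i, c_i)`. -/
noncomputable def smoothedRisk {X : Type*} [MeasurableSpace X] {K n : ℕ}
    (π₀ : Kernel X (Fin K)) (α : ℝ) (D : Fin n → X × Fin K × ℝ) (π : Kernel X (Fin K)) : ℝ :=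
  1 / (n : ℝ) * ∑ i, (D i).2.2 *
    (prob π (D i).1 (D i).2.1 / prob π₀ (D i).1 (D i).2.1 ^ α)

/-- The bias term `1 - (1/n) ∑ i, E_{a ∼ π(· | x_i)} [π₀(a | x_i) ^ (1 - α)]`. -/
noncomputable def biasTerm {X : Type*} [MeasurableSpace X] {K n : ℕ}
    (π₀ : Kernel X (Fin K)) (α : ℝ) (D : Fin n → X × Fin K × ℝ) (π : Kernel X (Fin K)) : ℝ :=
  1 - 1 / (n : ℝ) * ∑ i, ∫ a, prob π₀ (D i).1 a ^ (1 - α) ∂(π (D i).1)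

/-- The second moment term `(1/n) ∑ i, (E_{a ∼ π₀(· | x_i)} [π(a | x_i) / π₀(a | x_i) ^ (2α)]
+ π(a_i | x_i) / π₀(a_i | x_i) ^ (2α) * c_i ^ 2)`. -/
noncomputable def secondMoment {X : Type*} [MeasurableSpace X] {K n : ℕ}
    (π₀ : Kernel X (Fin K)) (α : ℝ) (D : Fin n → X × Fin K × ℝ) (π : Kernel X (Fin K)) : ℝ :=
  1 / (n : ℝ) * ∑ i,
    ((∫ a, prob π (D i).1 a / prob π₀ (D i).1 a ^ (2 * α) ∂(π₀ (D i).1)) +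
      prob π (D i).1 (D i).2.1 / prob π₀ (D i).1 (D i).2.1 ^ (2 * α) * (D i).2.2 ^ 2)

/-- `kl'₁ = KL(Q ‖ P) + log (8 √n / (δ lam))`, for `Q` with `KL(Q ‖ P) < ∞`. -/
noncomputable def klOne {H : Type*} [MeasurableSpace H]
    (P Q : Measure H) (n : ℕ) (δ lam : ℝ) : ℝ :=
  (klDiv Q P).toReal + Real.log (8 * √(n : ℝ) / (δ * lam))

/-- `kl'₂ = 2 (KL(Q ‖ P) + log (8 / (δ lam)))`, for `Q` with `KL(Q ‖ P) < ∞`. -/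
noncomputable def klTwo {H : Type*} [MeasurableSpace H]
    (P Q : Measure H) (δ lam : ℝ) : ℝ :=
  2 * ((klDiv Q P).toReal + Real.log (8 / (δ * lam)))

end OffPolicy

namespace OffPolicy

/-! The error is a sum of three parts, pivoting on `contextRisk` and `smoothedContextRisk`: the
sampling of contexts, the smoothing of the weights, and the sampling of actions and costs given the
contexts. The smoothing part is at most `biasTerm` for every data set. The two random parts are
averages over Q of quantities attached to a single hypothesis, so PAC-Bayes applies: bound an
exponential moment for each fixed hypothesis, integrate over the prior, exchange integrals, use
Markov's inequality on the data, and pass to all posteriors at once by `integral_le_klDiv_add_log`.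

For contexts, mean costs lie in [-1, 0], so Hoeffding's lemma controls the moment of exp(2nΔ²)
(`lintegral_exp_sq_sub_mean_le`), and Jensen's inequality yields the square root. For actions, the
weights have no uniform bound. Since costs are nonpositive, the negated weighted cost is
nonnegative, and `lintegral_exp_selfNormalized_le_one` gives an exponential moment at most 1 for
every real t, the price being the second moment term.

The parameter t must not depend on the data. A union bound over t = 2^-(i+1) is used, and λ is
rounded down to such a t with t < λ ≤ 2t; this produces log(8/(δλ)) and the factor 2 in `klTwo`. -/

/-! ### Self-normalized exponential inequality. -/

/-- The logarithmic gap has derivative y times a positive function, so its minimum is its value 0 at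
the origin. Being valid on the whole line, the bound needs no boundedness of the variable, only two
moments. -/
theorem exp_sub_sq_div_two_le (x : ℝ) : Real.exp (x - x ^ 2 / 2) ≤ 1 + x + x ^ 2 / 2 := by
  have hpos : ∀ y : ℝ, 0 < 1 + y + y ^ 2 / 2 := fun y => by nlinarith [sq_nonneg (y + 1)]
  let f : ℝ → ℝ := fun y => Real.log (1 + y + y ^ 2 / 2) - (y - y ^ 2 / 2)
  have hf : ∀ y, HasDerivAt f (y * (1 + y / 2 + y ^ 2 / 2) / (1 + y + y ^ 2 / 2)) y := by
    intro y
    have h1 : HasDerivAt (fun y : ℝ => 1 + y + y ^ 2 / 2) (1 + y) y := by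
      have := ((hasDerivAt_id y).const_add 1).add ((hasDerivAt_pow 2 y).div_const 2)
      convert! this using 1
      simp
    have h2 : HasDerivAt (fun y : ℝ => y - y ^ 2 / 2) (1 - y) y := by
      have := (hasDerivAt_id y).sub ((hasDerivAt_pow 2 y).div_const 2)
      convert! this using 1
      simp
    convert! (h1.log (hpos y).ne').sub h2 using 1
    rw [eq_sub_iff_add_eq, div_add' _ _ _ (hpos y).ne']
    congr 1
    ring
  have hc : Continuous f := continuous_iff_continuousAt.2 fun y => (hf y).continuousAt
  have hq : ∀ y : ℝ, 0 < 1 + y / 2 + y ^ 2 / 2 := fun y => by nlinarith [sq_nonneg (y + 1/2)]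
  have hmono : MonotoneOn f (Set.Ici 0) := by
    refine monotoneOn_of_deriv_nonneg (convex_Ici 0) hc.continuousOn
      (fun y _ => (hf y).differentiableAt.differentiableWithinAt) fun y hy => ?_
    rw [interior_Ici, Set.mem_Ioi] at hy
    rw [(hf y).deriv]
    exact div_nonneg (mul_nonneg hy.le (hq y).le) (hpos y).le
  have hanti : AntitoneOn f (Set.Iic 0) := by
    refine antitoneOn_of_deriv_nonpos (convex_Iic 0) hc.continuousOn
      (fun y _ => (hf y).differentiableAt.differentiableWithinAt) fun y hy => ?_
    rw [interior_Iic, Set.mem_Iio] at hy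
    rw [(hf y).deriv]
    exact div_nonpos_of_nonpos_of_nonneg (mul_nonpos_of_nonpos_of_nonneg hy.le (hq y).le)
      (hpos y).le
  have h0 : f 0 = 0 := by simp [f]
  have hfx : 0 ≤ f x := by
    rcases le_total 0 x with hx | hx
    · exact h0 ▸ hmono Set.self_mem_Ici hx hx
    · exact h0 ▸ hanti hx Set.self_mem_Iic hx
  rw [← Real.le_log_iff_exp_le (hpos x)]
  simp only [f] at hfx
  linarith

/-- A self-normalized exponential inequality for a nonnegative square-integrable variable. -/
theorem lintegral_exp_selfNormalized_le_one {Ω : Type*} [MeasurableSpace Ω] {μ : Measure Ω}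
    [IsProbabilityMeasure μ] {W : Ω → ℝ} (hW : MemLp W 2 μ) (hW0 : 0 ≤ᵐ[μ] W) {S : ℝ}
    (hS : ∫ ω, W ω ^ 2 ∂μ ≤ S) (t : ℝ) :
    ∫⁻ ω, ENNReal.ofReal
      (Real.exp (t * (W ω - ∫ ω, W ω ∂μ) - t ^ 2 / 2 * (W ω ^ 2 + S))) ∂μ ≤ 1 := by
  set m := ∫ ω, W ω ∂μ with hm
  have hm0 : 0 ≤ m := integral_nonneg_of_ae hW0
  have hWi : Integrable W μ := hW.integrable (by norm_num)
  have hW2 : Integrable (fun ω => W ω ^ 2) μ := hW.integrable_sq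
  set s := ∫ ω, W ω ^ 2 ∂μ with hs
  set v := s - m ^ 2 with hv
  -- The quadratic bound at x = t(W - m), times exp(-u) with u = t²v/2 and v the variance. Its mean
  -- is (1 + u)exp(-u) ≤ 1.
  set g : Ω → ℝ := fun ω => (1 + t * (W ω - m) + t ^ 2 / 2 * (W ω ^ 2 - 2 * m * W ω + m ^ 2)) *
    Real.exp (-(t ^ 2 / 2 * v)) with hg
  have hgi : Integrable g μ := by
    refine Integrable.mul_const ?_ _
    exact ((integrable_const 1).add ((hWi.sub (integrable_const m)).const_mul t)).add
      (((hW2.sub (hWi.const_mul (2 * m))).add (integrable_const (m ^ 2))).const_mul (t ^ 2 / 2))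
  have hg_eq : ∫ ω, g ω ∂μ = (1 + t ^ 2 / 2 * v) * Real.exp (-(t ^ 2 / 2 * v)) := by
    rw [hg, integral_mul_const]
    congr 1
    have i1 : Integrable (fun ω => 1 + t * (W ω - m)) μ :=
      (integrable_const 1).add ((hWi.sub (integrable_const m)).const_mul t)
    have i2 : Integrable (fun ω => W ω ^ 2 - 2 * m * W ω) μ := hW2.sub (hWi.const_mul (2 * m))
    have i3 : Integrable (fun ω => W ω ^ 2 - 2 * m * W ω + m ^ 2) μ :=
      i2.add (integrable_const (m ^ 2))
    have i4 : Integrable (fun ω => W ω - m) μ := hWi.sub (integrable_const m)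
    rw [integral_add i1 (i3.const_mul (t ^ 2 / 2)),
      integral_add (integrable_const 1) (i4.const_mul t),
      integral_const_mul, integral_const_mul, integral_sub hWi (integrable_const m),
      integral_add i2 (integrable_const (m ^ 2)), integral_sub hW2 (hWi.const_mul (2 * m)),
      integral_const_mul]
    simp only [integral_const, probReal_univ, smul_eq_mul, ← hm, ← hs]
    rw [hv]; ring
  have hle : ∀ᵐ ω ∂μ,
      Real.exp (t * (W ω - m) - t ^ 2 / 2 * (W ω ^ 2 + S)) ≤ g ω := by
    filter_upwards [hW0] with ω hω
    have hω : 0 ≤ W ω := hω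
    have h1 := exp_sub_sq_div_two_le (t * (W ω - m))
    -- Here (W - m)² + v = W² - 2mW + s; the cross term can be dropped because W and m are
    -- nonnegative.
    have h2 : t * (W ω - m) - t ^ 2 / 2 * (W ω ^ 2 + S) ≤
        (t * (W ω - m) - (t * (W ω - m)) ^ 2 / 2) + -(t ^ 2 / 2 * v) := by
      have h3 : 0 ≤ t ^ 2 / 2 * (2 * (m * W ω) + (S - s)) :=
        mul_nonneg (by positivity) (by linarith [mul_nonneg hm0 hω])
      rw [hv]
      nlinarith [h3]
    refine (Real.exp_le_exp.2 h2).trans ?_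
    rw [Real.exp_add]
    refine (mul_le_mul_of_nonneg_right h1 (Real.exp_pos _).le).trans (le_of_eq ?_)
    rw [hg]; ring
  have hg0 : 0 ≤ᵐ[μ] g := by
    filter_upwards [hle] with ω hω using (Real.exp_pos _).le.trans hω
  calc _ ≤ ∫⁻ ω, ENNReal.ofReal (g ω) ∂μ :=
        lintegral_mono_ae (by filter_upwards [hle] with ω hω using ENNReal.ofReal_le_ofReal hω)
    _ = ENNReal.ofReal (∫ ω, g ω ∂μ) := (ofReal_integral_eq_lintegral_ofReal hgi hg0).symm
    _ ≤ ENNReal.ofReal 1 := by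
        refine ENNReal.ofReal_le_ofReal ?_
        rw [hg_eq]
        calc _ ≤ Real.exp (t ^ 2 / 2 * v) * Real.exp (-(t ^ 2 / 2 * v)) := by
              refine mul_le_mul_of_nonneg_right ?_ (Real.exp_pos _).le
              linarith [Real.add_one_le_exp (t ^ 2 / 2 * v)]
          _ = 1 := by rw [← Real.exp_add]; simp
    _ = 1 := ENNReal.ofReal_one

/-! ### Change of measure. -/

/-- One direction of the Donsker-Varadhan variational formula, for bounded functions. -/
theorem integral_le_klDiv_add_log {H : Type*} [MeasurableSpace H] {P Q : Measure H}
    [IsProbabilityMeasure P] [IsProbabilityMeasure Q] (hQP : klDiv Q P ≠ ∞) {f : H → ℝ}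
    (hf : Measurable f) {b : ℝ} (hb : ∀ h, |f h| ≤ b) {C : ℝ} (hC0 : 0 ≤ C)
    (hC : ∫⁻ h, ENNReal.ofReal (Real.exp (f h)) ∂P ≤ ENNReal.ofReal C) :
    ∫ h, f h ∂Q ≤ (klDiv Q P).toReal + Real.log C := by
  obtain ⟨hac, hint⟩ := klDiv_ne_top_iff.1 hQP
  have hfQ : Integrable f Q :=
    Integrable.of_bound hf.aestronglyMeasurable b (ae_of_all _ fun h => hb h)
  have hfP : Integrable (fun h => Real.exp (f h)) P := by
    refine Integrable.of_bound hf.exp.aestronglyMeasurable (Real.exp b) (ae_of_all _ fun h => ?_)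
    rw [Real.norm_eq_abs, Real.abs_exp]
    exact Real.exp_le_exp.2 ((le_abs_self _).trans (hb h))
  -- The slack in the variational formula is the divergence of Q from the tilted prior, which is
  -- nonnegative.
  have hpt : IsProbabilityMeasure (P.tilted f) := isProbabilityMeasure_tilted hfP
  have hac' : Q ≪ P.tilted f := hac.trans (absolutelyContinuous_tilted hfP)
  have h1 := integral_llr_tilted_right hac hfQ hfP hint
  have h2 : 0 ≤ ∫ x, llr Q (P.tilted f) x ∂Q := by
    have h3 := integral_llr_add_sub_measure_univ_nonneg hac'
      (integrable_llr_tilted_right hac hfQ hint hfP)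
    simpa using h3
  have h4 : (klDiv Q P).toReal = ∫ x, llr Q P x ∂Q :=
    toReal_klDiv_of_measure_eq hac (by simp)
  have h5 : ∫ h, Real.exp (f h) ∂P ≤ C := by
    rw [← ofReal_integral_eq_lintegral_ofReal hfP (ae_of_all _ fun h => (Real.exp_pos _).le)] at hC
    exact (ENNReal.ofReal_le_ofReal_iff hC0).1 hC
  have h6 := Real.log_le_log (integral_exp_pos hfP) h5
  rw [h4]
  linarith

/-! ### Exponential moments of squares. -/

theorem lintegral_exp_mul_sq_gaussianReal {b : ℝ} (hb : b < 1 / 2) :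
    ∫⁻ g, ENNReal.ofReal (Real.exp (b * g ^ 2)) ∂(gaussianReal 0 1) =
      ENNReal.ofReal (1 / √(1 - 2 * b)) := by
  rw [gaussianReal_of_var_ne_zero _ one_ne_zero,
    lintegral_withDensity_eq_lintegral_mul _ (measurable_gaussianPDF _ _) (by fun_prop)]
  have h1 : ∀ g : ℝ, (gaussianPDF 0 1 * fun g => ENNReal.ofReal (Real.exp (b * g ^ 2))) g =
      ENNReal.ofReal ((√(2 * Real.pi))⁻¹ * Real.exp (-(1 / 2 - b) * g ^ 2)) := by
    intro g
    simp only [Pi.mul_apply, gaussianPDF, gaussianPDFReal]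
    rw [← ENNReal.ofReal_mul (by positivity), mul_assoc, ← Real.exp_add]
    congr 2
    · simp
    · congr 1
      simp
      ring
  simp_rw [h1]
  rw [← ofReal_integral_eq_lintegral_ofReal
    ((integrable_exp_neg_mul_sq (by linarith)).const_mul _) (ae_of_all _ fun g => by positivity),
    integral_const_mul, integral_gaussian, ← Real.sqrt_inv, ← Real.sqrt_mul (by positivity),
    one_div (√_), ← Real.sqrt_inv]
  congr 2
  have : (1 : ℝ) / 2 - b ≠ 0 := by linarith
  have : (1 : ℝ) - 2 * b ≠ 0 := by linarith
  have := Real.pi_ne_zero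
  field_simp

/-- Exponential moments of the square of a sub-Gaussian variable. -/
theorem lintegral_exp_mul_sq_le {Ω : Type*} [MeasurableSpace Ω] {μ : Measure Ω}
    [IsProbabilityMeasure μ] {Y : Ω → ℝ} {c : NNReal} (hY : Measurable Y)
    (hsub : HasSubgaussianMGF Y c μ) {b : ℝ} (hb0 : 0 ≤ b) (hb : 2 * b * c < 1) :
    ∫⁻ ω, ENNReal.ofReal (Real.exp (b * Y ω ^ 2)) ∂μ ≤
      ENNReal.ofReal (1 / √(1 - 2 * b * c)) := by
  -- Gaussian linearization: exp(by²) is the standard Gaussian moment generating function at √(2b)y.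
  -- After exchanging integrals only that of Y is needed.
  have h1 : ∀ y : ℝ, ENNReal.ofReal (Real.exp (b * y ^ 2)) =
      ∫⁻ g, ENNReal.ofReal (Real.exp (√(2 * b) * y * g)) ∂(gaussianReal 0 1) := by
    intro y
    rw [← ofReal_integral_eq_lintegral_ofReal (integrable_exp_mul_gaussianReal _)
      (ae_of_all _ fun g => (Real.exp_pos _).le)]
    have h2 := congrFun (mgf_fun_id_gaussianReal (μ := 0) (v := 1)) (√(2 * b) * y)
    rw [mgf] at h2
    rw [h2]
    congr 2
    rw [mul_pow, Real.sq_sqrt (by positivity)]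
    simp
    ring
  simp_rw [h1]
  rw [lintegral_lintegral_swap (by fun_prop)]
  calc _ ≤ ∫⁻ g, ENNReal.ofReal (Real.exp (b * c * g ^ 2)) ∂(gaussianReal 0 1) := by
        refine lintegral_mono fun g => ?_
        have h3 : ∀ ω, √(2 * b) * Y ω * g = √(2 * b) * g * Y ω := fun ω => by ring
        simp_rw [h3]
        rw [← ofReal_integral_eq_lintegral_ofReal (hsub.integrable_exp_mul _)
          (ae_of_all _ fun g => (Real.exp_pos _).le)]
        refine ENNReal.ofReal_le_ofReal ((hsub.mgf_le _).trans (le_of_eq ?_))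
        rw [mul_pow, Real.sq_sqrt (by positivity)]
        congr 1
        ring
    _ = _ := by
        rw [lintegral_exp_mul_sq_gaussianReal (by linarith)]
        congr 4
        ring

/-- The exponential moment of the squared deviation of an empirical mean. -/
theorem lintegral_exp_sq_sub_mean_le {Ω : Type*} [MeasurableSpace Ω] {μ : Measure Ω}
    [IsProbabilityMeasure μ] {n : ℕ} (hn : 1 ≤ n) {g : Ω → ℝ} (hg : Measurable g)
    (hg1 : ∀ ω, g ω ∈ Set.Icc (-1 : ℝ) 0) :
    ∫⁻ D, ENNReal.ofReal
      (Real.exp (2 * n * ((∫ ω, g ω ∂μ) - 1 / (n : ℝ) * ∑ i, g (D i)) ^ 2))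
        ∂(Measure.pi fun _ : Fin n => μ) ≤ ENNReal.ofReal (4 * √(n : ℝ)) := by
  have hn0 : (1 : ℝ) ≤ n := by exact_mod_cast hn
  have hnp : (0 : ℝ) < n := by linarith
  set m := ∫ ω, g ω ∂μ with hm
  set Y : (Fin n → Ω) → ℝ := fun D => ∑ i, (g (D i) - m) with hYdef
  have hYm : Measurable Y := by fun_prop
  have hYeq : ∀ D, m - 1 / (n : ℝ) * ∑ i, g (D i) = -(Y D / n) := by
    intro D
    simp only [hYdef, Finset.sum_sub_distrib, Finset.sum_const, Finset.card_univ, Fintype.card_fin,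
      nsmul_eq_mul]
    field_simp
    ring
  have hgi : Integrable g μ :=
    Integrable.of_mem_Icc (-1) 0 hg.aemeasurable (ae_of_all _ hg1)
  have hm1 : -1 ≤ m := by
    have := integral_mono (integrable_const (-1 : ℝ)) hgi fun ω => (hg1 ω).1
    simpa using this
  have hm0 : m ≤ 0 := integral_nonpos fun ω => (hg1 ω).2
  have habs : ∀ D, |Y D| ≤ n := by
    intro D
    refine (Finset.abs_sum_le_sum_abs _ _).trans ?_
    calc _ ≤ ∑ _i : Fin n, (1 : ℝ) := Finset.sum_le_sum fun i _ => by
          rw [abs_le]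
          constructor <;> linarith [(hg1 (D i)).1, (hg1 (D i)).2]
      _ = n := by simp
  have hsub : HasSubgaussianMGF Y ((n : NNReal) / 4) (Measure.pi fun _ : Fin n => μ) := by
    have h1 : HasSubgaussianMGF (fun ω => g ω - m) (1 / 4) μ := by
      have := hasSubgaussianMGF_of_mem_Icc (μ := μ) hg.aemeasurable (ae_of_all _ hg1)
      convert this using 1
      ext
      norm_num
    have h2 : iIndepFun (fun i (D : Fin n → Ω) => g (D i) - m) (Measure.pi fun _ => μ) :=
      iIndepFun_pi (X := fun _ ω => g ω - m) fun i => (hg.sub_const m).aemeasurable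
    have h3 : ∀ i ∈ (Finset.univ : Finset (Fin n)),
        HasSubgaussianMGF (fun D : Fin n → Ω => g (D i) - m) (1 / 4) (Measure.pi fun _ => μ) := by
      intro i _
      have h4 := (measurePreserving_eval (fun _ : Fin n => μ) i)
      refine HasSubgaussianMGF.of_map (Y := fun D : Fin n → Ω => D i) (X := fun ω => g ω - m)
        h4.measurable.aemeasurable ?_
      have h5 := h4.map_eq
      rw [show (fun D : Fin n → Ω => D i) = Function.eval i from rfl, h5]
      exact h1
    have h6 := HasSubgaussianMGF.sum_of_iIndepFun h2 h3
    convert h6 using 1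
    simp
    ring
  -- The target exponent is 2Y²/n, and b = 2/n is exactly critical for the parameter n/4. Setting
  -- aside Y²/(2n²) ≤ 1/2 leaves 1 - 2bc = 1/(4n), hence 2√n; the part set aside costs exp(1/2) ≤ 2.
  have key := lintegral_exp_mul_sq_le hYm hsub (b := (2 - 1 / (2 * n)) / n)
    (div_nonneg (by rw [sub_nonneg, div_le_iff₀ (by positivity)]; linarith) hnp.le)
    (by push_cast; rw [show 2 * ((2 - 1 / (2 * (n : ℝ))) / n) * (n / 4) = 1 - 1 / (4 * n) by
          field_simp; ring]
        linarith [show 0 < 1 / (4 * (n : ℝ)) by positivity])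
  have hval : 1 / √(1 - 2 * ((2 - 1 / (2 * (n : ℝ))) / n) * ((n / 4 : NNReal) : ℝ)) = 2 * √n := by
    push_cast
    rw [show 1 - 2 * ((2 - 1 / (2 * (n : ℝ))) / n) * (n / 4) = (2 ^ 2 * (n : ℝ))⁻¹ by
      field_simp; ring, Real.sqrt_inv, one_div, inv_inv, Real.sqrt_mul (by positivity),
      Real.sqrt_sq (by norm_num)]
  rw [hval] at key
  calc _ ≤ ∫⁻ D, ENNReal.ofReal (Real.exp (1 / 2)) *
          ENNReal.ofReal (Real.exp ((2 - 1 / (2 * n)) / n * Y D ^ 2))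
          ∂(Measure.pi fun _ : Fin n => μ) := by
        refine lintegral_mono fun D => ?_
        rw [← ENNReal.ofReal_mul (Real.exp_pos _).le, ← Real.exp_add]
        refine ENNReal.ofReal_le_ofReal (Real.exp_le_exp.2 ?_)
        rw [hYeq]
        have h7 : Y D ^ 2 ≤ (n : ℝ) ^ 2 := by
          rw [← sq_abs]
          exact pow_le_pow_left₀ (abs_nonneg _) (habs D) 2
        have h8 : 2 * n * (-(Y D / n)) ^ 2 =
            Y D ^ 2 / (n : ℝ) ^ 2 / 2 + (2 - 1 / (2 * n)) / n * Y D ^ 2 := by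
          field_simp
          ring
        rw [h8]
        have h9 : Y D ^ 2 / (n : ℝ) ^ 2 ≤ 1 := (div_le_one (by positivity)).2 h7
        linarith
    _ = ENNReal.ofReal (Real.exp (1 / 2)) *
          ∫⁻ D, ENNReal.ofReal (Real.exp ((2 - 1 / (2 * n)) / n * Y D ^ 2))
          ∂(Measure.pi fun _ : Fin n => μ) := lintegral_const_mul _ (by fun_prop)
    _ ≤ ENNReal.ofReal (Real.exp (1 / 2)) * ENNReal.ofReal (2 * √n) := by gcongr
    _ ≤ _ := by
        rw [← ENNReal.ofReal_mul (Real.exp_pos _).le]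
        refine ENNReal.ofReal_le_ofReal ?_
        have h10 : Real.exp (1 / 2) ≤ 2 := by
          rw [← Real.le_log_iff_exp_le two_pos]
          linarith [Real.log_two_gt_d9]
        nlinarith [Real.sqrt_nonneg (n : ℝ)]

/-! ### Independent samples and the union bound. -/

theorem lintegral_exp_sum_le_one {Ω : Type*} [MeasurableSpace Ω] {μ : Measure Ω}
    [IsProbabilityMeasure μ] {n : ℕ} {g : Ω → ℝ} (hg : Measurable g)
    (hg1 : ∫⁻ ω, ENNReal.ofReal (Real.exp (g ω)) ∂μ ≤ 1) :
    ∫⁻ D, ENNReal.ofReal (Real.exp (∑ i, g (D i))) ∂(Measure.pi fun _ : Fin n => μ) ≤ 1 := by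
  have hgm : Measurable fun ω => ENNReal.ofReal (Real.exp (g ω)) := by fun_prop
  have h2 : iIndepFun (fun i (D : Fin n → Ω) => ENNReal.ofReal (Real.exp (g (D i))))
      (Measure.pi fun _ => μ) :=
    iIndepFun_pi (X := fun _ ω => ENNReal.ofReal (Real.exp (g ω))) fun i => hgm.aemeasurable
  simp_rw [Real.exp_sum, ENNReal.ofReal_prod_of_nonneg fun i _ => (Real.exp_pos _).le]
  rw [lintegral_prod_eq_prod_lintegral_of_indepFun _ _ h2 fun i => by fun_prop]
  refine Finset.prod_le_one' fun i _ => ?_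
  rw [(measurePreserving_eval (fun _ : Fin n => μ) i).lintegral_comp hgm]
  exact hg1

/-- If countably many nonnegative variables have expectation at most one, then with probability
at least `1 - δ` the `i`-th one is at most `2 ^ (i + 1) / δ`, for all `i` at once. -/
theorem exists_measurableSet_forall_le {Ω : Type*} [MeasurableSpace Ω] {μ : Measure Ω}
    [IsProbabilityMeasure μ] {f : ℕ → Ω → ℝ≥0∞} (hf : ∀ i, Measurable (f i))
    (hf1 : ∀ i, ∫⁻ ω, f i ω ∂μ ≤ 1) {δ : ℝ} (hδ : 0 < δ) :
    ∃ E : Set Ω, MeasurableSet E ∧ ENNReal.ofReal (1 - δ) ≤ μ E ∧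
      ∀ ω ∈ E, ∀ i, f i ω ≤ ENNReal.ofReal (2 ^ (i + 1) / δ) := by
  set c : ℕ → ℝ≥0∞ := fun i => ENNReal.ofReal (2 ^ (i + 1) / δ) with hc
  have hcpos : ∀ i, (0 : ℝ) < 2 ^ (i + 1) / δ := fun i => by positivity
  have hbad : μ (⋃ i, {ω | c i ≤ f i ω}) ≤ ENNReal.ofReal δ := by
    calc _ ≤ ∑' i, μ {ω | c i ≤ f i ω} := measure_iUnion_le _
      _ ≤ ∑' i : ℕ, ENNReal.ofReal (δ / 2 / 2 ^ i) := by
          refine ENNReal.tsum_le_tsum fun i => ?_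
          refine (meas_ge_le_lintegral_div (hf i).aemeasurable
            (ENNReal.ofReal_pos.2 (hcpos i)).ne' ENNReal.ofReal_ne_top).trans ?_
          refine (ENNReal.div_le_div_right (hf1 i) _).trans (le_of_eq ?_)
          rw [one_div, ← ENNReal.ofReal_inv_of_pos (hcpos i)]
          congr 1
          field_simp
          ring
      _ = ENNReal.ofReal δ := by
          rw [← ENNReal.ofReal_tsum_of_nonneg (fun i => by positivity) (summable_geometric_two' δ),
            tsum_geometric_two']
  have hm : MeasurableSet (⋃ i, {ω | c i ≤ f i ω}) :=
    MeasurableSet.iUnion fun i => measurableSet_le measurable_const (hf i)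
  refine ⟨(⋃ i, {ω | c i ≤ f i ω})ᶜ, hm.compl, ?_, fun ω hω i => ?_⟩
  · rw [prob_compl_eq_one_sub hm, ENNReal.ofReal_sub _ hδ.le, ENNReal.ofReal_one]
    exact tsub_le_tsub_left hbad 1
  · simp only [Set.mem_compl_iff, Set.mem_iUnion, Set.mem_ofPred_eq, not_exists, not_le] at hω
    exact (hω i).le

/-! ### Policies and the loss of a single action. -/

section Policy

variable {X H : Type*} [MeasurableSpace X] [MeasurableSpace H] {K : ℕ}

theorem prob_nonneg (π : Kernel X (Fin K)) (x : X) (a : Fin K) : 0 ≤ prob π x a :=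
  measureReal_nonneg

theorem prob_le_one (π : Kernel X (Fin K)) [IsMarkovKernel π] (x : X) (a : Fin K) :
    prob π x a ≤ 1 :=
  measureReal_le_one

theorem sum_prob (π : Kernel X (Fin K)) [IsMarkovKernel π] (x : X) :
    ∑ a, prob π x a = 1 := by
  have h := integral_fintype (μ := π x) (f := fun _ : Fin K => (1 : ℝ)) Integrable.of_finite
  simp only [integral_const, probReal_univ, smul_eq_mul, mul_one] at h
  exact h.symm

theorem integral_policy (π : Kernel X (Fin K)) [IsMarkovKernel π] (x : X) (g : Fin K → ℝ) :
    ∫ a, g a ∂(π x) = ∑ a, prob π x a * g a :=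
  integral_fintype Integrable.of_finite

theorem measurable_prob (π : Kernel X (Fin K)) :
    Measurable fun z : X × Fin K => prob π z.1 z.2 :=
  measurable_from_prod_countable_left fun a =>
    (π.measurable_coe (measurableSet_singleton a)).ennreal_toReal

/-- Converts averages over the posterior into expectations under the induced policy. -/
theorem integral_comp_pred (pred : H → X → Fin K)
    (hpred : Measurable (fun z : H × X => pred z.1 z.2)) (Q : Measure H) [IsProbabilityMeasure Q]
    (x : X) (g : Fin K → ℝ) :
    ∫ h, g (pred h x) ∂Q = ∑ a, prob (inducedPolicy pred hpred Q) x a * g a := by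
  rw [← integral_policy]
  exact (integral_map (hpred.comp (measurable_id.prodMk measurable_const)).aemeasurable
    (measurable_of_finite g).aestronglyMeasurable).symm

/-- The expected cost of an action in a context. -/
noncomputable def meanCost (p : Kernel (X × Fin K) ℝ) (z : X × Fin K) : ℝ :=
  ∫ c, c ∂(p z)

theorem measurable_meanCost (p : Kernel (X × Fin K) ℝ) [IsMarkovKernel p] :
    Measurable (meanCost p) :=
  (StronglyMeasurable.integral_kernel (κ := p) stronglyMeasurable_id).measurable

theorem meanCost_mem_Icc {p : Kernel (X × Fin K) ℝ} [IsMarkovKernel p]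
    (hp : ∀ x a, ∀ᵐ c ∂(p (x, a)), c ∈ Set.Icc (-1 : ℝ) 0) (z : X × Fin K) :
    meanCost p z ∈ Set.Icc (-1 : ℝ) 0 := by
  have hz := hp z.1 z.2
  have hi : Integrable (fun c : ℝ => c) (p z) :=
    Integrable.of_mem_Icc (-1) 0 measurable_id.aemeasurable hz
  constructor
  · have := integral_mono_ae (integrable_const (-1 : ℝ)) hi (hz.mono fun c hc => hc.1)
    simpa [meanCost] using this
  · exact integral_nonpos_of_ae (hz.mono fun c hc => hc.2)

/-- The smoothed importance-weighted loss of the deterministic action `b`. -/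
noncomputable def loss (π₀ : Kernel X (Fin K)) (α : ℝ) (b : Fin K) (z : X × Fin K × ℝ) : ℝ :=
  if b = z.2.1 then -z.2.2 / prob π₀ z.1 z.2.1 ^ α else 0

/-- The conditional mean of `loss` given the context. -/
noncomputable def meanLoss (π₀ : Kernel X (Fin K)) (p : Kernel (X × Fin K) ℝ) (α : ℝ) (b : Fin K)
    (x : X) : ℝ :=
  prob π₀ x b / prob π₀ x b ^ α * -meanCost p (x, b)

/-- A bound for the conditional second moment of `loss` given the context. -/
noncomputable def lossSqBound (π₀ : Kernel X (Fin K)) (α : ℝ) (b : Fin K) (x : X) : ℝ :=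
  prob π₀ x b / prob π₀ x b ^ (2 * α)

/-- The exponent of the self-normalized exponential inequality for `loss`. -/
noncomputable def lossExponent (π₀ : Kernel X (Fin K)) (p : Kernel (X × Fin K) ℝ) (α t : ℝ)
    (b : Fin K) (z : X × Fin K × ℝ) : ℝ :=
  t * (loss π₀ α b z - meanLoss π₀ p α b z.1) -
    t ^ 2 / 2 * (loss π₀ α b z ^ 2 + lossSqBound π₀ α b z.1)

theorem rpow_sq {q : ℝ} (hq : 0 ≤ q) (α : ℝ) : (q ^ α) ^ 2 = q ^ (2 * α) := by
  rw [mul_comm, Real.rpow_mul hq, Real.rpow_two]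

theorem measurable_loss (π₀ : Kernel X (Fin K)) (α : ℝ) (b : Fin K) :
    Measurable (loss π₀ α b) := by
  unfold loss
  have h := (measurable_prob π₀).comp
    (measurable_fst.prodMk (measurable_fst.comp measurable_snd) :
      Measurable fun z : X × Fin K × ℝ => (z.1, z.2.1))
  refine Measurable.ite ?_ (measurable_snd.snd.neg.div (h.pow_const α)) measurable_const
  exact (measurable_snd.fst : Measurable fun z : X × Fin K × ℝ => z.2.1)
    (Set.toFinite {a : Fin K | b = a}).measurableSet

theorem measurable_lossExponent (π₀ : Kernel X (Fin K)) (p : Kernel (X × Fin K) ℝ)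
    [IsMarkovKernel p] (α t : ℝ) (b : Fin K) :
    Measurable (lossExponent π₀ p α t b) := by
  have h0 := measurable_loss π₀ α b
  have hz : Measurable fun z : X × Fin K × ℝ => (z.1, b) := measurable_fst.prodMk measurable_const
  have h1 := (measurable_prob π₀).comp hz
  have h2 := (measurable_meanCost p).comp hz
  exact (((h0.sub ((h1.div (h1.pow_const α)).mul h2.neg)).const_mul t)).sub
    (((h0.pow_const 2).add (h1.div (h1.pow_const (2 * α)))).const_mul (t ^ 2 / 2))

theorem measurable_lossExponent_pred (π₀ : Kernel X (Fin K)) (p : Kernel (X × Fin K) ℝ)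
    [IsMarkovKernel p] (α t : ℝ) {pred : H → X → Fin K}
    (hpred : Measurable (fun z : H × X => pred z.1 z.2)) :
    Measurable fun w : H × (X × Fin K × ℝ) => lossExponent π₀ p α t (pred w.1 w.2.1) w.2 := by
  have h : Measurable fun w : (X × Fin K × ℝ) × Fin K => lossExponent π₀ p α t w.2 w.1 :=
    measurable_from_prod_countable_left fun b => measurable_lossExponent π₀ p α t b
  exact h.comp (measurable_snd.prodMk
    (hpred.comp (measurable_fst.prodMk (measurable_fst.comp measurable_snd))))

variable (π₀ : Kernel X (Fin K)) [IsMarkovKernel π₀] (p : Kernel (X × Fin K) ℝ) [IsMarkovKernel p]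

theorem ae_cost_mem_Icc (hp : ∀ x a, ∀ᵐ c ∂(p (x, a)), c ∈ Set.Icc (-1 : ℝ) 0) (x : X) :
    ∀ᵐ w ∂((π₀ ⊗ₖ p) x), w.2 ∈ Set.Icc (-1 : ℝ) 0 := by
  rw [Kernel.ae_compProd_iff (measurable_snd measurableSet_Icc)]
  exact ae_of_all _ fun a => hp x a

theorem integral_indicator_compProd (x : X) (b : Fin K) {g : ℝ → ℝ}
    (hg : Integrable (fun w : Fin K × ℝ => if b = w.1 then g w.2 else 0) ((π₀ ⊗ₖ p) x)) :
    ∫ w, (if b = w.1 then g w.2 else 0) ∂((π₀ ⊗ₖ p) x) = prob π₀ x b * ∫ c, g c ∂(p (x, b)) := by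
  rw [ProbabilityTheory.integral_compProd hg, integral_policy, Finset.sum_eq_single b]
  · simp
  · intro a _ hab
    simp [hab.symm]
  · simp

/-- Given the context, the loss lives on the event that b is logged, so its moments are q times
those of -c/q^α, and c² ≤ 1 bounds the second. The bound 1/q^α on the loss serves integrability
only. -/
theorem lintegral_exp_lossExponent_le_one (hp : ∀ x a, ∀ᵐ c ∂(p (x, a)), c ∈ Set.Icc (-1 : ℝ) 0)
    (α t : ℝ) (x : X) (b : Fin K) :
    ∫⁻ w, ENNReal.ofReal (Real.exp (lossExponent π₀ p α t b (x, w))) ∂((π₀ ⊗ₖ p) x) ≤ 1 := by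
  set q := prob π₀ x b with hq
  have hq0 : 0 ≤ q := prob_nonneg π₀ x b
  have hqa : 0 ≤ q ^ α := Real.rpow_nonneg hq0 α
  have hae := ae_cost_mem_Icc π₀ p hp x
  have hloss : ∀ w : Fin K × ℝ,
      loss π₀ α b (x, w) = if b = w.1 then -w.2 / q ^ α else 0 := by
    intro w
    by_cases h : b = w.1
    · subst h; simp [loss, hq]
    · simp [loss, h]
  have hloss2 : ∀ w : Fin K × ℝ,
      loss π₀ α b (x, w) ^ 2 = if b = w.1 then (-w.2 / q ^ α) ^ 2 else 0 := by
    intro w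
    rw [hloss]
    split_ifs <;> simp
  have hmeas : Measurable fun w : Fin K × ℝ => loss π₀ α b (x, w) :=
    (measurable_loss π₀ α b).comp measurable_prodMk_left
  have hL2 : MemLp (fun w : Fin K × ℝ => loss π₀ α b (x, w)) 2 ((π₀ ⊗ₖ p) x) := by
    refine MemLp.of_bound hmeas.aestronglyMeasurable (1 / q ^ α) ?_
    filter_upwards [hae] with w hw
    rw [hloss]
    split_ifs
    · rw [Real.norm_eq_abs, abs_div, abs_of_nonneg hqa]
      gcongr
      rw [abs_le]; constructor <;> linarith [hw.1, hw.2]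
    · simpa using hqa
  have h0 : 0 ≤ᵐ[(π₀ ⊗ₖ p) x] fun w : Fin K × ℝ => loss π₀ α b (x, w) := by
    filter_upwards [hae] with w hw
    rw [hloss]
    split_ifs
    · exact div_nonneg (by linarith [hw.2]) hqa
    · exact le_rfl
  have hmean : ∫ w, loss π₀ α b (x, w) ∂((π₀ ⊗ₖ p) x) = meanLoss π₀ p α b x := by
    have hi : Integrable (fun w : Fin K × ℝ => loss π₀ α b (x, w)) ((π₀ ⊗ₖ p) x) :=
      hL2.integrable (by norm_num)
    simp_rw [hloss] at hi ⊢
    rw [integral_indicator_compProd π₀ p x b (g := fun c => -c / q ^ α) hi, integral_div,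
      integral_neg, meanLoss, meanCost, ← hq]
    ring
  have hsq : ∫ w, loss π₀ α b (x, w) ^ 2 ∂((π₀ ⊗ₖ p) x) ≤ lossSqBound π₀ α b x := by
    have hi := hL2.integrable_sq
    simp_rw [hloss2] at hi ⊢
    rw [integral_indicator_compProd π₀ p x b (g := fun c => (-c / q ^ α) ^ 2) hi]
    simp_rw [div_pow, neg_sq]
    rw [integral_div, lossSqBound, ← hq, rpow_sq hq0]
    have hc : ∫ c, c ^ 2 ∂(p (x, b)) ≤ 1 := by
      have hle : ∀ᵐ c ∂(p (x, b)), c ^ 2 ≤ (1 : ℝ) := by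
        filter_upwards [hp x b] with c hc
        nlinarith [hc.1, hc.2]
      have hci : Integrable (fun c : ℝ => c ^ 2) (p (x, b)) := by
        refine Integrable.of_bound (by fun_prop) 1 ?_
        filter_upwards [hle] with c hc
        rwa [Real.norm_eq_abs, abs_of_nonneg (sq_nonneg c)]
      simpa using integral_mono_ae hci (integrable_const (1 : ℝ)) hle
    rw [div_eq_mul_inv, div_eq_mul_inv]
    refine mul_le_mul_of_nonneg_left ?_ hq0
    exact mul_le_of_le_one_left (inv_nonneg.2 (Real.rpow_nonneg hq0 _)) hc
  have key := lintegral_exp_selfNormalized_le_one hL2 h0 hsq t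
  rw [hmean] at key
  exact key

variable (ν : Measure X) [IsProbabilityMeasure ν]

instance : IsProbabilityMeasure (jointLaw ν π₀ p) := by
  unfold jointLaw; infer_instance

theorem integral_fst_jointLaw {g : X → ℝ} (hg : Measurable g) :
    ∫ z, g z.1 ∂(jointLaw ν π₀ p) = ∫ x, g x ∂ν := by
  have h : (jointLaw ν π₀ p).fst = ν := Measure.fst_compProd ν (π₀ ⊗ₖ p)
  conv_rhs => rw [← h]
  rw [Measure.fst, integral_map measurable_fst.aemeasurable hg.aestronglyMeasurable]

theorem lintegral_jointLaw_exp_lossExponent_le_one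
    (hp : ∀ x a, ∀ᵐ c ∂(p (x, a)), c ∈ Set.Icc (-1 : ℝ) 0) {pred : H → X → Fin K}
    (hpred : Measurable (fun z : H × X => pred z.1 z.2)) (α t : ℝ) (h : H) :
    ∫⁻ z, ENNReal.ofReal (Real.exp (lossExponent π₀ p α t (pred h z.1) z))
      ∂(jointLaw ν π₀ p) ≤ 1 := by
  have hm : Measurable fun z : X × Fin K × ℝ => lossExponent π₀ p α t (pred h z.1) z :=
    (measurable_lossExponent_pred π₀ p α t hpred).comp measurable_prodMk_left
  rw [jointLaw, Measure.lintegral_compProd hm.exp.ennreal_ofReal]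
  calc _ ≤ ∫⁻ _x, 1 ∂ν :=
        lintegral_mono fun x => lintegral_exp_lossExponent_le_one π₀ p hp α t x (pred h x)
    _ = 1 := by simp

theorem risk_eq (hp : ∀ x a, ∀ᵐ c ∂(p (x, a)), c ∈ Set.Icc (-1 : ℝ) 0) :
    risk ν p π₀ = ∫ x, ∑ a, prob π₀ x a * meanCost p (x, a) ∂ν := by
  have hae : ∀ᵐ z ∂(jointLaw ν π₀ p), z.2.2 ∈ Set.Icc (-1 : ℝ) 0 := by
    have hs : MeasurableSet {z : X × Fin K × ℝ | z.2.2 ∈ Set.Icc (-1 : ℝ) 0} :=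
      (measurable_snd.comp measurable_snd) measurableSet_Icc
    rw [jointLaw, Measure.ae_compProd_iff hs]
    exact ae_of_all _ fun x => ae_cost_mem_Icc π₀ p hp x
  have hi : Integrable (fun z : X × Fin K × ℝ => z.2.2) (jointLaw ν π₀ p) :=
    Integrable.of_mem_Icc (-1) 0 (by fun_prop) hae
  rw [risk, jointLaw, Measure.integral_compProd hi]
  congr 1
  ext x
  have hix : Integrable (fun w : Fin K × ℝ => w.2) ((π₀ ⊗ₖ p) x) :=
    Integrable.of_mem_Icc (-1) 0 (by fun_prop) (ae_cost_mem_Icc π₀ p hp x)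
  rw [ProbabilityTheory.integral_compProd hix, integral_policy]
  rfl

end Policy

/-! ### The three error terms. -/

section Bound

variable {X H : Type*} [MeasurableSpace X] [MeasurableSpace H] {K n : ℕ}
  (π₀ : Kernel X (Fin K)) (p : Kernel (X × Fin K) ℝ)

/-- The deviation of the empirical contextual risk of a hypothesis from its risk. -/
noncomputable def contextDeviation (ν : Measure X) (p : Kernel (X × Fin K) ℝ)
    (pred : H → X → Fin K) (D : Fin n → X × Fin K × ℝ) (h : H) : ℝ :=
  (∫ x, meanCost p (x, pred h x) ∂ν) - 1 / (n : ℝ) * ∑ i, meanCost p ((D i).1, pred h (D i).1)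

/-- The mean contextual risk of a policy on the observed contexts. -/
noncomputable def contextRisk (p : Kernel (X × Fin K) ℝ) (D : Fin n → X × Fin K × ℝ)
    (π : Kernel X (Fin K)) : ℝ :=
  1 / (n : ℝ) * ∑ i, ∑ a, prob π (D i).1 a * meanCost p ((D i).1, a)

/-- The conditional mean of `smoothedRisk` given the observed contexts. -/
noncomputable def smoothedContextRisk (π₀ : Kernel X (Fin K)) (p : Kernel (X × Fin K) ℝ) (α : ℝ)
    (D : Fin n → X × Fin K × ℝ) (π : Kernel X (Fin K)) : ℝ :=
  -(1 / (n : ℝ) * ∑ i, ∑ a, prob π (D i).1 a * meanLoss π₀ p α a (D i).1)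

theorem measurable_contextDeviation (ν : Measure X) [IsProbabilityMeasure ν] [IsMarkovKernel p]
    {pred : H → X → Fin K} (hpred : Measurable (fun z : H × X => pred z.1 z.2)) :
    Measurable fun w : (Fin n → X × Fin K × ℝ) × H => contextDeviation ν p pred w.1 w.2 := by
  have h1 : Measurable fun z : H × X => meanCost p (z.2, pred z.1 z.2) :=
    (measurable_meanCost p).comp (measurable_snd.prodMk hpred)
  have h2 : Measurable fun h : H => ∫ x, meanCost p (x, pred h x) ∂ν :=
    (StronglyMeasurable.integral_prod_right (f := fun h x => meanCost p (x, pred h x))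
      h1.stronglyMeasurable).measurable
  refine (h2.comp measurable_snd).sub ((Finset.measurable_sum _ fun i _ => ?_).const_mul _)
  have h3 : Measurable fun w : (Fin n → X × Fin K × ℝ) × H => (w.2, (w.1 i).1) := by fun_prop
  exact h1.comp h3

theorem abs_contextDeviation_le (ν : Measure X) [IsProbabilityMeasure ν] [IsMarkovKernel p]
    (hp : ∀ x a, ∀ᵐ c ∂(p (x, a)), c ∈ Set.Icc (-1 : ℝ) 0) {pred : H → X → Fin K}
    (hpred : Measurable (fun z : H × X => pred z.1 z.2)) (D : Fin n → X × Fin K × ℝ)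
    (h : H) : |contextDeviation ν p pred D h| ≤ 1 := by
  have hi : Integrable (fun x => meanCost p (x, pred h x)) ν :=
    Integrable.of_mem_Icc (-1) 0 ((measurable_meanCost p).comp
      (measurable_id.prodMk (hpred.comp measurable_prodMk_left))).aemeasurable
      (ae_of_all _ fun x => meanCost_mem_Icc hp _)
  have h1 : -1 ≤ ∫ x, meanCost p (x, pred h x) ∂ν := by
    have := integral_mono (integrable_const (-1 : ℝ)) hi fun x => (meanCost_mem_Icc hp _).1
    simpa using this
  have h2 : ∫ x, meanCost p (x, pred h x) ∂ν ≤ 0 :=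
    integral_nonpos fun x => (meanCost_mem_Icc hp _).2
  have h3 : ∑ i, meanCost p ((D i).1, pred h (D i).1) ≤ 0 :=
    Finset.sum_nonpos fun i _ => (meanCost_mem_Icc hp _).2
  have h4 : -(n : ℝ) ≤ ∑ i, meanCost p ((D i).1, pred h (D i).1) := by
    have := Finset.sum_le_sum (s := Finset.univ)
      fun (i : Fin n) _ => (meanCost_mem_Icc hp ((D i).1, pred h (D i).1)).1
    simpa using this
  have h5 : 1 / (n : ℝ) * ∑ i, meanCost p ((D i).1, pred h (D i).1) ≤ 0 :=
    mul_nonpos_of_nonneg_of_nonpos (by positivity) h3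
  have h6 : -1 ≤ 1 / (n : ℝ) * ∑ i, meanCost p ((D i).1, pred h (D i).1) := by
    have h7 : 1 / (n : ℝ) * -(n : ℝ) ≤ 1 / (n : ℝ) * ∑ i, meanCost p ((D i).1, pred h (D i).1) :=
      mul_le_mul_of_nonneg_left h4 (by positivity)
    -- For n = 0 the empirical mean is 0, since 1 / 0 = 0.
    rcases eq_or_ne (n : ℝ) 0 with h0 | h0
    · rw [h0] at h7 ⊢; simp
    · rwa [mul_neg, one_div_mul_cancel h0] at h7
  rw [contextDeviation, abs_le]
  constructor <;> linarith

theorem integral_contextDeviation (ν : Measure X) [IsProbabilityMeasure ν] [IsMarkovKernel p]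
    (hp : ∀ x a, ∀ᵐ c ∂(p (x, a)), c ∈ Set.Icc (-1 : ℝ) 0) (pred : H → X → Fin K)
    (hpred : Measurable (fun z : H × X => pred z.1 z.2)) (D : Fin n → X × Fin K × ℝ)
    (Q : Measure H) [IsProbabilityMeasure Q] :
    ∫ h, contextDeviation ν p pred D h ∂Q =
      risk ν p (inducedPolicy pred hpred Q) - contextRisk p D (inducedPolicy pred hpred Q) := by
  have h1 : Measurable fun z : H × X => meanCost p (z.2, pred z.1 z.2) :=
    (measurable_meanCost p).comp (measurable_snd.prodMk hpred)
  have hi : Integrable (fun z : H × X => meanCost p (z.2, pred z.1 z.2)) (Q.prod ν) :=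
    Integrable.of_mem_Icc (-1) 0 h1.aemeasurable (ae_of_all _ fun z => meanCost_mem_Icc hp _)
  have hix : ∀ x, Integrable (fun h => meanCost p (x, pred h x)) Q := fun x =>
    Integrable.of_mem_Icc (-1) 0 (h1.comp (measurable_id.prodMk measurable_const)).aemeasurable
      (ae_of_all _ fun h => meanCost_mem_Icc hp _)
  unfold contextDeviation
  rw [integral_sub hi.integral_prod_left
    ((integrable_finsetSum _ fun i _ => hix (D i).1).const_mul _), integral_const_mul,
    integral_finsetSum _ fun i _ => hix (D i).1,
    integral_integral_swap (f := fun h x => meanCost p (x, pred h x)) hi, risk_eq _ _ _ hp,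
    contextRisk]
  congr 2
  · ext x
    exact integral_comp_pred pred hpred Q x fun a => meanCost p (x, a)
  · exact Finset.sum_congr rfl fun i _ =>
      integral_comp_pred pred hpred Q (D i).1 fun a => meanCost p ((D i).1, a)

/-- The change of measure is applied to 2nΔ² rather than to Δ; Jensen's inequality, as nonnegativity
of the variance, then gives a bound with no parameter to tune. -/
theorem abs_risk_sub_contextRisk_le (ν : Measure X) [IsProbabilityMeasure ν] [IsMarkovKernel p]
    (hp : ∀ x a, ∀ᵐ c ∂(p (x, a)), c ∈ Set.Icc (-1 : ℝ) 0) (pred : H → X → Fin K)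
    (hpred : Measurable (fun z : H × X => pred z.1 z.2)) (hn : 1 ≤ n)
    (D : Fin n → X × Fin K × ℝ) {P Q : Measure H} [IsProbabilityMeasure P]
    [IsProbabilityMeasure Q] (hQP : klDiv Q P ≠ ∞) {C : ℝ} (hC0 : 0 ≤ C)
    (hC : ∫⁻ h, ENNReal.ofReal (Real.exp (2 * n * contextDeviation ν p pred D h ^ 2)) ∂P ≤
      ENNReal.ofReal C) :
    |risk ν p (inducedPolicy pred hpred Q) - contextRisk p D (inducedPolicy pred hpred Q)| ≤
      √(((klDiv Q P).toReal + Real.log C) / (2 * n)) := by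
  have hnp : (0 : ℝ) < n := by exact_mod_cast hn
  set Δ : H → ℝ := contextDeviation ν p pred D with hΔ
  have hm : Measurable Δ := (measurable_contextDeviation p ν hpred).comp measurable_prodMk_left
  have hb : ∀ h, |Δ h| ≤ 1 := abs_contextDeviation_le p ν hp hpred D
  have hsq : ∀ h, Δ h ^ 2 ≤ 1 := fun h => (sq_le_one_iff_abs_le_one _).2 (hb h)
  have hdv := integral_le_klDiv_add_log hQP (f := fun h => 2 * n * Δ h ^ 2) (b := 2 * n)
    (by fun_prop) (fun h => by
      rw [abs_of_nonneg (by positivity)]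
      exact mul_le_of_le_one_right (by positivity) (hsq h)) hC0 hC
  rw [integral_const_mul] at hdv
  have hL2 : MemLp Δ 2 Q := MemLp.of_bound hm.aestronglyMeasurable 1 (ae_of_all _ hb)
  have hvar : (∫ h, Δ h ∂Q) ^ 2 ≤ ∫ h, Δ h ^ 2 ∂Q := by
    have h1 := variance_nonneg Δ Q
    rw [variance_eq_sub hL2] at h1
    simpa using h1
  rw [← integral_contextDeviation p ν hp pred hpred D Q]
  refine Real.abs_le_sqrt (hvar.trans ?_)
  rw [le_div_iff₀ (by positivity)]
  linarith

/-- Smoothing multiplies each mean cost by π₀^(1-α), and mean costs are at most 1 in absolute value.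
-/
theorem abs_contextRisk_sub_smoothedContextRisk_le [IsMarkovKernel π₀] [IsMarkovKernel p]
    (hp : ∀ x a, ∀ᵐ c ∂(p (x, a)), c ∈ Set.Icc (-1 : ℝ) 0) (hn : 1 ≤ n) {α : ℝ}
    (hα : α ∈ Set.Icc (0 : ℝ) 1) (D : Fin n → X × Fin K × ℝ) (π : Kernel X (Fin K))
    [IsMarkovKernel π] (hac : α = 1 → ∀ x, π x ≪ π₀ x) :
    |contextRisk p D π - smoothedContextRisk π₀ p α D π| ≤ biasTerm π₀ α D π := by
  have hnp : (0 : ℝ) < n := by exact_mod_cast hn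
  have hterm : ∀ x a, |prob π x a * meanCost p (x, a) + prob π x a * meanLoss π₀ p α a x| ≤
      prob π x a * (1 - prob π₀ x a ^ (1 - α)) := by
    intro x a
    have hπ := prob_nonneg π x a
    have hq0 := prob_nonneg π₀ x a
    have hq1 := prob_le_one π₀ x a
    have hr1 : prob π₀ x a ^ (1 - α) ≤ 1 := Real.rpow_le_one hq0 hq1 (by linarith [hα.2])
    have hc : |meanCost p (x, a)| ≤ 1 := by
      rw [abs_le]
      have := meanCost_mem_Icc hp (x, a)
      constructor <;> linarith [this.1, this.2]
    have hmain : prob π x a * (prob π₀ x a / prob π₀ x a ^ α) =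
        prob π x a * prob π₀ x a ^ (1 - α) := by
      -- At π₀ = 0 the quotient is 0, while 0^(1-α) is 0 for α < 1 but 1 for α = 1. In the latter
      -- case absolute continuity makes π vanish.
      rcases hq0.eq_or_lt with hq | hq
      · rcases hα.2.eq_or_lt with h1 | h1
        · have hz : prob π x a = 0 := by
            have h2 : π₀ x {a} = 0 := by
              rcases (ENNReal.toReal_eq_zero_iff _).1 hq.symm with h | h
              · exact h
              · exact absurd h (measure_ne_top _ _)
            simp [prob, measureReal_def, hac h1 x h2]
          simp [hz]
        · rw [← hq, Real.zero_rpow (by linarith : 1 - α ≠ 0)]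
          simp
      · rw [Real.rpow_sub hq, Real.rpow_one]
    have heq : prob π x a * meanCost p (x, a) + prob π x a * meanLoss π₀ p α a x =
        prob π x a * (1 - prob π₀ x a ^ (1 - α)) * meanCost p (x, a) := by
      rw [meanLoss]
      linear_combination (-meanCost p (x, a)) * hmain
    have h3 : 0 ≤ prob π x a * (1 - prob π₀ x a ^ (1 - α)) :=
      mul_nonneg hπ (sub_nonneg.2 hr1)
    rw [heq, abs_mul, abs_of_nonneg h3]
    exact mul_le_of_le_one_right h3 hc
  have hbias : biasTerm π₀ α D π =
      1 / (n : ℝ) * ∑ i, ∑ a, prob π (D i).1 a * (1 - prob π₀ (D i).1 a ^ (1 - α)) := by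
    simp_rw [biasTerm, integral_policy, mul_sub, mul_one, Finset.sum_sub_distrib, sum_prob]
    rw [Finset.sum_const, Finset.card_univ, Fintype.card_fin, nsmul_eq_mul, mul_one, mul_sub,
      one_div_mul_cancel hnp.ne']
  have hdiff : contextRisk p D π - smoothedContextRisk π₀ p α D π = 1 / (n : ℝ) * ∑ i, ∑ a,
      (prob π (D i).1 a * meanCost p ((D i).1, a) +
        prob π (D i).1 a * meanLoss π₀ p α a (D i).1) := by
    simp_rw [Finset.sum_add_distrib]
    rw [contextRisk, smoothedContextRisk]
    ring
  rw [hdiff, hbias, abs_mul, abs_of_nonneg (by positivity : (0 : ℝ) ≤ 1 / n)]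
  refine mul_le_mul_of_nonneg_left ?_ (by positivity)
  refine (Finset.abs_sum_le_sum_abs _ _).trans (Finset.sum_le_sum fun i _ => ?_)
  exact (Finset.abs_sum_le_sum_abs _ _).trans (Finset.sum_le_sum fun a _ => hterm _ a)

/-- The loss of one action carries an indicator, which equals its square; so the averaged squared
loss is linear in π, and `secondMoment` contains π rather than π². -/
theorem sum_prob_mul_lossExponent (α t : ℝ) (π : Kernel X (Fin K)) [IsMarkovKernel π₀]
    (z : X × Fin K × ℝ) :
    ∑ b, prob π z.1 b * lossExponent π₀ p α t b z =
      t * (-(z.2.2 * (prob π z.1 z.2.1 / prob π₀ z.1 z.2.1 ^ α)) -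
        ∑ b, prob π z.1 b * meanLoss π₀ p α b z.1) -
      t ^ 2 / 2 * ((∫ a, prob π z.1 a / prob π₀ z.1 a ^ (2 * α) ∂(π₀ z.1)) +
        prob π z.1 z.2.1 / prob π₀ z.1 z.2.1 ^ (2 * α) * z.2.2 ^ 2) := by
  have h1 : ∑ b, prob π z.1 b * loss π₀ α b z =
      -(z.2.2 * (prob π z.1 z.2.1 / prob π₀ z.1 z.2.1 ^ α)) := by
    rw [Finset.sum_eq_single z.2.1]
    · simp only [loss, if_true]
      ring
    · intro b _ hb
      simp [loss, hb]
    · simp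
  have h2 : ∑ b, prob π z.1 b * loss π₀ α b z ^ 2 =
      prob π z.1 z.2.1 / prob π₀ z.1 z.2.1 ^ (2 * α) * z.2.2 ^ 2 := by
    rw [Finset.sum_eq_single z.2.1]
    · simp only [loss, if_true]
      rw [div_pow, rpow_sq (prob_nonneg _ _ _)]
      ring
    · intro b _ hb
      simp [loss, hb]
    · simp
  have h3 : ∫ a, prob π z.1 a / prob π₀ z.1 a ^ (2 * α) ∂(π₀ z.1) =
      ∑ b, prob π z.1 b * lossSqBound π₀ α b z.1 := by
    rw [integral_policy]
    refine Finset.sum_congr rfl fun b _ => ?_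
    rw [lossSqBound]
    ring
  rw [← h1, ← h2, h3, ← Finset.sum_sub_distrib, ← Finset.sum_add_distrib, Finset.mul_sum,
    Finset.mul_sum, ← Finset.sum_sub_distrib]
  refine Finset.sum_congr rfl fun b _ => ?_
  rw [lossExponent]
  ring

/-- The factor nt is kept undivided so that t of either sign is covered. -/
theorem mul_smoothedContextRisk_sub_smoothedRisk_le [IsMarkovKernel π₀] [IsMarkovKernel p]
    (pred : H → X → Fin K) (hpred : Measurable (fun z : H × X => pred z.1 z.2)) (hn : 1 ≤ n)
    (D : Fin n → X × Fin K × ℝ) {P Q : Measure H} [IsProbabilityMeasure P]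
    [IsProbabilityMeasure Q] (hQP : klDiv Q P ≠ ∞) (α t : ℝ) {C : ℝ} (hC0 : 0 ≤ C)
    (hC : ∫⁻ h, ENNReal.ofReal
      (Real.exp (∑ i, lossExponent π₀ p α t (pred h (D i).1) (D i))) ∂P ≤ ENNReal.ofReal C) :
    n * t * (smoothedContextRisk π₀ p α D (inducedPolicy pred hpred Q) -
        smoothedRisk π₀ α D (inducedPolicy pred hpred Q)) ≤
      (klDiv Q P).toReal + Real.log C +
        n * t ^ 2 / 2 * secondMoment π₀ α D (inducedPolicy pred hpred Q) := by
  have hnp : (0 : ℝ) < n := by exact_mod_cast hn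
  set π := inducedPolicy pred hpred Q with hπ
  have hterm : ∀ i, Measurable fun h => lossExponent π₀ p α t (pred h (D i).1) (D i) := fun i =>
    (measurable_lossExponent_pred π₀ p α t hpred).comp (measurable_id.prodMk measurable_const)
  -- For fixed data the exponent takes finitely many values, one per action, hence is bounded in h.
  have hbd : ∀ i h, |lossExponent π₀ p α t (pred h (D i).1) (D i)| ≤
      ∑ b, |lossExponent π₀ p α t b (D i)| := fun i h =>
    Finset.single_le_sum (f := fun b => |lossExponent π₀ p α t b (D i)|)
      (fun b _ => abs_nonneg _) (Finset.mem_univ _)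
  have hint : ∀ i, Integrable (fun h => lossExponent π₀ p α t (pred h (D i).1) (D i)) Q := fun i =>
    Integrable.of_bound (hterm i).aestronglyMeasurable _ (ae_of_all _ (hbd i))
  have hdv := integral_le_klDiv_add_log hQP
    (f := fun h => ∑ i, lossExponent π₀ p α t (pred h (D i).1) (D i))
    (Finset.measurable_sum _ fun i _ => hterm i)
    (fun h => (Finset.abs_sum_le_sum_abs _ _).trans (Finset.sum_le_sum fun i _ => hbd i h)) hC0 hC
  rw [integral_finsetSum _ fun i _ => hint i] at hdv
  simp_rw [fun i => integral_comp_pred pred hpred Q (D i).1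
    fun b => lossExponent π₀ p α t b (D i), ← hπ, sum_prob_mul_lossExponent] at hdv
  rw [Finset.sum_sub_distrib, ← Finset.mul_sum, ← Finset.mul_sum, Finset.sum_sub_distrib,
    Finset.sum_neg_distrib] at hdv
  have hV : ∑ i, ((∫ a, prob π (D i).1 a / prob π₀ (D i).1 a ^ (2 * α) ∂(π₀ (D i).1)) +
      prob π (D i).1 (D i).2.1 / prob π₀ (D i).1 (D i).2.1 ^ (2 * α) * (D i).2.2 ^ 2) =
      n * secondMoment π₀ α D π := by
    rw [secondMoment, ← mul_assoc, mul_one_div_cancel hnp.ne', one_mul]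
  have hR : ∑ i, (D i).2.2 * (prob π (D i).1 (D i).2.1 / prob π₀ (D i).1 (D i).2.1 ^ α) =
      n * smoothedRisk π₀ α D π := by
    rw [smoothedRisk, ← mul_assoc, mul_one_div_cancel hnp.ne', one_mul]
  have hS : ∑ i, ∑ a, prob π (D i).1 a * meanLoss π₀ p α a (D i).1 =
      -(n * smoothedContextRisk π₀ p α D π) := by
    rw [smoothedContextRisk, mul_neg, neg_neg, ← mul_assoc, mul_one_div_cancel hnp.ne', one_mul]
  rw [hV, hR, hS] at hdv
  linarith

theorem secondMoment_nonneg (α : ℝ) (D : Fin n → X × Fin K × ℝ) (π : Kernel X (Fin K)) :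
    0 ≤ secondMoment π₀ α D π := by
  have h : ∀ x a, 0 ≤ prob π x a / prob π₀ x a ^ (2 * α) := fun x a =>
    div_nonneg (prob_nonneg _ _ _) (Real.rpow_nonneg (prob_nonneg _ _ _) _)
  exact mul_nonneg (by positivity) (Finset.sum_nonneg fun i _ =>
    add_nonneg (integral_nonneg fun a => h _ a) (mul_nonneg (h _ _) (sq_nonneg _)))

/-- The signs ±t give the two sides of the absolute value. Replacing t by λ is safe in the second
moment term as t ≤ λ, and costs a factor 2 in 1/(nt) as λ ≤ 2t. -/
theorem abs_smoothedContextRisk_sub_smoothedRisk_le [IsMarkovKernel π₀] [IsMarkovKernel p]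
    (pred : H → X → Fin K) (hpred : Measurable (fun z : H × X => pred z.1 z.2)) (hn : 1 ≤ n)
    (D : Fin n → X × Fin K × ℝ) {P Q : Measure H} [IsProbabilityMeasure P]
    [IsProbabilityMeasure Q] (hQP : klDiv Q P ≠ ∞) (α : ℝ) {δ lam t : ℝ}
    (hδ : δ ∈ Set.Ioc (0 : ℝ) 1) (hlam : lam ∈ Set.Ioo (0 : ℝ) 1) (ht : t ≤ lam)
    (hlt : lam ≤ 2 * t)
    (hC : ∀ s : ℝ, |s| = t → ∫⁻ h, ENNReal.ofReal
      (Real.exp (∑ i, lossExponent π₀ p α s (pred h (D i).1) (D i))) ∂P ≤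
        ENNReal.ofReal (4 / (t * δ))) :
    |smoothedContextRisk π₀ p α D (inducedPolicy pred hpred Q) -
        smoothedRisk π₀ α D (inducedPolicy pred hpred Q)| ≤
      klTwo P Q δ lam / (n * lam) +
        lam / 2 * secondMoment π₀ α D (inducedPolicy pred hpred Q) := by
  have hnp : (0 : ℝ) < n := by exact_mod_cast hn
  have hl0 := hlam.1
  have hδ0 := hδ.1
  have htp : 0 < t := by linarith
  set π := inducedPolicy pred hpred Q
  have hV := secondMoment_nonneg π₀ α D π
  have h1 := mul_smoothedContextRisk_sub_smoothedRisk_le π₀ p pred hpred hn D hQP α t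
    (by positivity) (hC t (abs_of_pos htp))
  have h2 := mul_smoothedContextRisk_sub_smoothedRisk_le π₀ p pred hpred hn D hQP α (-t)
    (by positivity) (hC (-t) (by rw [abs_neg, abs_of_pos htp]))
  set M := smoothedContextRisk π₀ p α D π - smoothedRisk π₀ α D π
  set V := secondMoment π₀ α D π
  set kl := (klDiv Q P).toReal with hkl
  have hlog : Real.log (4 / (t * δ)) ≤ Real.log (8 / (δ * lam)) := by
    refine Real.log_le_log (by positivity) ?_
    rw [div_le_div_iff₀ (by positivity) (by positivity)]
    nlinarith
  -- Nonnegativity is needed to enlarge 1/t to 2/λ in front of this term.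
  have hL0 : 0 ≤ kl + Real.log (8 / (δ * lam)) := by
    refine add_nonneg ENNReal.toReal_nonneg (Real.log_nonneg ?_)
    rw [le_div_iff₀ (by positivity)]
    nlinarith [mul_le_one₀ hδ.2 hl0.le hlam.2.le]
  set L := kl + Real.log (8 / (δ * lam)) with hL
  have habs : |M| * (n * t) ≤ L + n * t ^ 2 / 2 * V := by
    rcases abs_cases M with ⟨h, _⟩ | ⟨h, _⟩
    · rw [h]; linarith
    · rw [h]; linarith
  have h3 : |M| ≤ L / (n * t) + t / 2 * V := by
    have h4 : L / (n * t) + t / 2 * V = (L + n * t ^ 2 / 2 * V) / (n * t) := by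
      field_simp
    rw [h4, le_div_iff₀ (by positivity)]
    exact habs
  have h5 : L / (n * t) ≤ 2 * L / (n * lam) := by
    rw [div_le_div_iff₀ (by positivity) (by positivity)]
    have : 0 ≤ L * n * (2 * t - lam) := mul_nonneg (by positivity) (by linarith)
    linarith
  have h6 : t / 2 * V ≤ lam / 2 * V := mul_le_mul_of_nonneg_right (by linarith) hV
  rw [klTwo, ← hkl, ← hL]
  linarith

end Bound

end OffPolicy

/-! ### Dyadic grid and assembly. -/

/-- With probability at least `1 - δ` over the logged data, the two-sided bound holds for all
posteriors `Q` and all `lam ∈ (0, 1)` at once. If `KL(Q ‖ P) = ∞` the bound is `∞`, whence the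
finiteness condition; absolute continuity of `π_Q` is asked for only when `α = 1`. -/
theorem mainTheorem5 {X H : Type*} [MeasurableSpace X] [MeasurableSpace H] {K : ℕ}
    (ν : Measure X) [IsProbabilityMeasure ν]
    (π₀ : Kernel X (Fin K)) [IsMarkovKernel π₀]
    (p : Kernel (X × Fin K) ℝ) [IsMarkovKernel p]
    (hp : ∀ x a, ∀ᵐ c ∂(p (x, a)), c ∈ Set.Icc (-1 : ℝ) 0)
    (pred : H → X → Fin K) (hpred : Measurable (fun z : H × X => pred z.1 z.2))
    (n : ℕ) (hn : 1 ≤ n)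
    (δ : ℝ) (hδ : δ ∈ Set.Ioc (0 : ℝ) 1)
    (α : ℝ) (hα : α ∈ Set.Icc (0 : ℝ) 1)
    (P : Measure H) [IsProbabilityMeasure P] :
    ∃ E : Set (Fin n → X × Fin K × ℝ), MeasurableSet E ∧
      ENNReal.ofReal (1 - δ) ≤
        Measure.pi (fun _ : Fin n => OffPolicy.jointLaw ν π₀ p) E ∧
      ∀ D ∈ E, ∀ (Q : Measure H) [IsProbabilityMeasure Q],
        klDiv Q P ≠ ∞ →
        (α = 1 → ∀ x, OffPolicy.inducedPolicy pred hpred Q x ≪ π₀ x) →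
        ∀ lam ∈ Set.Ioo (0 : ℝ) 1,
          |OffPolicy.risk ν p (OffPolicy.inducedPolicy pred hpred Q) -
              OffPolicy.smoothedRisk π₀ α D (OffPolicy.inducedPolicy pred hpred Q)| ≤
            √(OffPolicy.klOne P Q n δ lam / (2 * n)) +
            OffPolicy.biasTerm π₀ α D (OffPolicy.inducedPolicy pred hpred Q) +
            OffPolicy.klTwo P Q δ lam / (n * lam) +
            lam / 2 * OffPolicy.secondMoment π₀ α D (OffPolicy.inducedPolicy pred hpred Q) := by
  have hnp : (1 : ℝ) ≤ n := by exact_mod_cast hn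
  have hδ0 := hδ.1
  have hs : 0 < 4 * √(n : ℝ) := by positivity
  set μ := Measure.pi (fun _ : Fin n => OffPolicy.jointLaw ν π₀ p) with hμ
  set A : (Fin n → X × Fin K × ℝ) → ℝ≥0∞ := fun D =>
    ∫⁻ h, ENNReal.ofReal (Real.exp (2 * n * OffPolicy.contextDeviation ν p pred D h ^ 2)) ∂P
    with hA
  set B : ℝ → (Fin n → X × Fin K × ℝ) → ℝ≥0∞ := fun t D =>
    ∫⁻ h, ENNReal.ofReal
      (Real.exp (∑ i, OffPolicy.lossExponent π₀ p α t (pred h (D i).1) (D i))) ∂P with hB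
  have hAk : Measurable fun w : (Fin n → X × Fin K × ℝ) × H => ENNReal.ofReal
      (Real.exp (2 * n * OffPolicy.contextDeviation ν p pred w.1 w.2 ^ 2)) :=
    (((OffPolicy.measurable_contextDeviation p ν hpred).pow_const 2).const_mul
      _).exp.ennreal_ofReal
  have hBk : ∀ t, Measurable fun w : (Fin n → X × Fin K × ℝ) × H => ENNReal.ofReal
      (Real.exp (∑ i, OffPolicy.lossExponent π₀ p α t (pred w.2 (w.1 i).1) (w.1 i))) := by
    intro t
    refine (Finset.measurable_sum _ fun i _ => ?_).exp.ennreal_ofReal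
    have h3 : Measurable fun w : (Fin n → X × Fin K × ℝ) × H => (w.2, w.1 i) := by fun_prop
    exact (OffPolicy.measurable_lossExponent_pred π₀ p α t hpred).comp h3
  have hAm : Measurable A := hAk.lintegral_prod_right'
  have hBm : ∀ t, Measurable (B t) := fun t => (hBk t).lintegral_prod_right'
  have hA1 : ∫⁻ D, A D ∂μ ≤ ENNReal.ofReal (4 * √(n : ℝ)) := by
    rw [hA, lintegral_lintegral_swap hAk.aemeasurable]
    calc _ ≤ ∫⁻ _h, ENNReal.ofReal (4 * √(n : ℝ)) ∂P := lintegral_mono fun h => by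
          have hg : Measurable fun x => OffPolicy.meanCost p (x, pred h x) :=
            (OffPolicy.measurable_meanCost p).comp
              (measurable_id.prodMk (hpred.comp measurable_prodMk_left))
          have := OffPolicy.lintegral_exp_sq_sub_mean_le (μ := OffPolicy.jointLaw ν π₀ p) hn
            (hg.comp measurable_fst) fun z => OffPolicy.meanCost_mem_Icc hp _
          simp only [Function.comp_apply] at this
          rw [OffPolicy.integral_fst_jointLaw π₀ p ν hg] at this
          exact this
      _ = _ := by simp
  have hB1 : ∀ t, ∫⁻ D, B t D ∂μ ≤ 1 := by
    intro t
    rw [hB, lintegral_lintegral_swap (hBk t).aemeasurable]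
    calc _ ≤ ∫⁻ _h, 1 ∂P := lintegral_mono fun h =>
          OffPolicy.lintegral_exp_sum_le_one
            ((OffPolicy.measurable_lossExponent_pred π₀ p α t hpred).comp measurable_prodMk_left)
            (OffPolicy.lintegral_jointLaw_exp_lossExponent_le_one π₀ p ν hp hpred α t h)
      _ = 1 := by simp
  -- Index 0 is the normalized context moment. Index i + 1 averages the signs ±2^-(i+1), so one
  -- share of the confidence budget serves both.
  let f : ℕ → (Fin n → X × Fin K × ℝ) → ℝ≥0∞ := fun k D => k.casesOn
    (ENNReal.ofReal (1 / (4 * √(n : ℝ))) * A D)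
    fun i => ENNReal.ofReal (1 / 2) * (B ((1 / 2) ^ (i + 1)) D + B (-(1 / 2) ^ (i + 1)) D)
  have hfm : ∀ k, Measurable (f k) := by
    rintro (_ | i)
    · exact hAm.const_mul _
    · exact ((hBm _).add (hBm _)).const_mul _
  have hf1 : ∀ k, ∫⁻ D, f k D ∂μ ≤ 1 := by
    rintro (_ | i)
    · change ∫⁻ D, ENNReal.ofReal (1 / (4 * √(n : ℝ))) * A D ∂μ ≤ 1
      rw [lintegral_const_mul _ hAm]
      refine (mul_le_mul_right hA1 _).trans (le_of_eq ?_)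
      rw [← ENNReal.ofReal_mul (by positivity), one_div_mul_cancel hs.ne', ENNReal.ofReal_one]
    · change ∫⁻ D, ENNReal.ofReal (1 / 2) *
        (B ((1 / 2) ^ (i + 1)) D + B (-(1 / 2) ^ (i + 1)) D) ∂μ ≤ 1
      have hadd : Measurable fun D => B ((1 / 2) ^ (i + 1)) D + B (-(1 / 2) ^ (i + 1)) D :=
        (hBm _).add (hBm _)
      rw [lintegral_const_mul _ hadd, lintegral_add_left (hBm _)]
      refine (mul_le_mul_right (add_le_add (hB1 _) (hB1 _)) _).trans (le_of_eq ?_)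
      rw [← ENNReal.ofReal_one, ← ENNReal.ofReal_add zero_le_one zero_le_one,
        ← ENNReal.ofReal_mul (by positivity)]
      norm_num
  have hcancel : ∀ {a x c : ℝ} {y : ℝ≥0∞}, 0 < a → a * c = x → ENNReal.ofReal a * y ≤
      ENNReal.ofReal x → y ≤ ENNReal.ofReal c := by
    intro a x c y ha hx hy
    rw [← hx, ENNReal.ofReal_mul ha.le] at hy
    exact (ENNReal.mul_le_mul_iff_right (ENNReal.ofReal_pos.2 ha).ne' ENNReal.ofReal_ne_top).1 hy
  obtain ⟨E, hE, hE1, hE2⟩ := OffPolicy.exists_measurableSet_forall_le hfm hf1 hδ0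
  refine ⟨E, hE, hE1, fun D hD Q _ hQP hac lam hlam => ?_⟩
  have hl0 := hlam.1
  set π := OffPolicy.inducedPolicy pred hpred Q with hπ
  have hAD : A D ≤ ENNReal.ofReal (8 * √(n : ℝ) / δ) := by
    refine hcancel (a := 1 / (4 * √(n : ℝ))) (by positivity) ?_ (hE2 D hD 0)
    field_simp
    norm_num
  -- With t = 2^-(i+1) this gives t < λ ≤ 2t. The level 2^(i+2)/δ of index i + 1, doubled to undo
  -- the average, is 4/(tδ).
  obtain ⟨i, hi1, hi2⟩ := exists_nat_pow_near_of_lt_one hl0 hlam.2.le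
    (by norm_num : (0 : ℝ) < 1 / 2) (by norm_num)
  have hBD : B ((1 / 2) ^ (i + 1)) D + B (-(1 / 2) ^ (i + 1)) D ≤
      ENNReal.ofReal (4 / ((1 / 2) ^ (i + 1) * δ)) := by
    refine hcancel (a := 1 / 2) (by positivity) ?_ (hE2 D hD (i + 1))
    rw [one_div_pow]
    field_simp
    ring
  have h1 := OffPolicy.abs_risk_sub_contextRisk_le p ν hp pred hpred hn D hQP (by positivity) hAD
  have h2 := OffPolicy.abs_contextRisk_sub_smoothedContextRisk_le π₀ p hp hn hα D π hac
  have h3 := OffPolicy.abs_smoothedContextRisk_sub_smoothedRisk_le π₀ p pred hpred hn D hQP α hδ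
    hlam hi1.le (by rw [pow_succ]; linarith) fun s hs => by
      rcases eq_or_eq_neg_of_abs_eq hs with rfl | rfl
      · exact le_self_add.trans hBD
      · exact le_add_self.trans hBD
  -- The context bound is free of λ; the λ in `klOne` only weakens it, since λ < 1.
  have h4 : √(((klDiv Q P).toReal + Real.log (8 * √(n : ℝ) / δ)) / (2 * n)) ≤
      √(OffPolicy.klOne P Q n δ lam / (2 * n)) := by
    refine Real.sqrt_le_sqrt (div_le_div_of_nonneg_right ?_ (by positivity))
    rw [OffPolicy.klOne]
    refine add_le_add_right (Real.log_le_log (by positivity) ?_) _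
    exact div_le_div_of_nonneg_left (by positivity) (by positivity)
      (mul_le_of_le_one_right hδ0.le hlam.2.le)
  rw [← hπ] at h1 h3
  have h5 := abs_add_three (OffPolicy.risk ν p π - OffPolicy.contextRisk p D π)
    (OffPolicy.contextRisk p D π - OffPolicy.smoothedContextRisk π₀ p α D π)
    (OffPolicy.smoothedContextRisk π₀ p α D π - OffPolicy.smoothedRisk π₀ α D π)
  rw [sub_add_sub_cancel, sub_add_sub_cancel] at h5
  linarith
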